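/- Let $\ell_2=\ell_2(\mathbb N_0)$ be the complex Hilbert space of square-summable sequences, with standard unit vectors $(e_i)_{i\ge 0}$. Let $D$ be a Donoghue operator, that is, a bounded linear operator on $\ell_2$ such that $De_0=0$ and $De_i=w_ie_{i-1}$ for all $i\ge 1$, where $(w_i)_{i\ge1}$ is a sequence of non-zero complex numbers with $(|w_i|)$ monotone decreasing (not necessarily strictly) and $\sum_i|w_i|^2<\infty$. Let $D^*$ be the adjoint of $D$. A half-space of $\ell_2$ is a closed linear subspace $Y$ that has both infinite dimension and infinite codimension; it is invariant under an operator $T$ if $T(Y)\subseteq Y$, and almost invariant under $T$ if $T(Y)\subseteq Y+F$ for some finite-dimensional subspace $F$ of $\ell_2$. Then $D$ has an almost invariant half-space and $D^*$ has an almost invariant half-space, whereas neither $D$ nor $D^*$ has an invariant half-space. -/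

import Mathlib

/-- A half-space: a closed linear subspace of infinite dimension and infinite codimension. -/
def IsHalfSpace {X : Type*} [NormedAddCommGroup X] [NormedSpace ℂ X]
    (Y : Submodule ℂ X) : Prop :=
  IsClosed (Y : Set X) ∧ ¬ FiniteDimensional ℂ Y ∧ ¬ FiniteDimensional ℂ (X ⧸ Y)

/-- `Y` is invariant under `T`: `T(Y) ⊆ Y`. -/
def IsInvariantUnder {X : Type*} [NormedAddCommGroup X] [NormedSpace ℂ X]
    (T : X →L[ℂ] X) (Y : Submodule ℂ X) : Prop :=
  ∀ y ∈ Y, T y ∈ Y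

/-- `Y` is almost invariant under `T`: `T(Y) ⊆ Y + F` for some finite-dimensional `F`. -/
def IsAlmostInvariantUnder {X : Type*} [NormedAddCommGroup X] [NormedSpace ℂ X]
    (T : X →L[ℂ] X) (Y : Submodule ℂ X) : Prop :=
  ∃ F : Submodule ℂ X, FiniteDimensional ℂ F ∧ ∀ y ∈ Y, T y ∈ Y ⊔ F

/-- `T` has an invariant half-space. -/
def HasInvariantHalfSpace {X : Type*} [NormedAddCommGroup X] [NormedSpace ℂ X]
    (T : X →L[ℂ] X) : Prop :=
  ∃ Y : Submodule ℂ X, IsHalfSpace Y ∧ IsInvariantUnder T Y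

/-- `T` has an almost invariant half-space. -/
def HasAlmostInvariantHalfSpace {X : Type*} [NormedAddCommGroup X] [NormedSpace ℂ X]
    (T : X →L[ℂ] X) : Prop :=
  ∃ Y : Submodule ℂ X, IsHalfSpace Y ∧ IsAlmostInvariantUnder T Y

/-- The bounded operator `D` on complex `ℓ²(ℕ)` is a Donoghue operator: with `eᵢ` the standard
unit vectors, `D e₀ = 0` and `D eᵢ = wᵢ eᵢ₋₁` for `i ≥ 1`, where `(wᵢ)`, `i ≥ 1`, is a
square-summable sequence of nonzero complex numbers whose moduli are decreasing (not necessarily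
strictly). The weight `wᵢ₊₁` is written `w i`. -/
def IsDonoghue (D : lp (fun _ : ℕ => ℂ) 2 →L[ℂ] lp (fun _ : ℕ => ℂ) 2) : Prop :=
  ∃ w : ℕ → ℂ,
    (∀ i, w i ≠ 0) ∧ Antitone (fun i => ‖w i‖) ∧ Summable (fun i => ‖w i‖ ^ 2) ∧
    D (lp.single 2 0 (1 : ℂ)) = 0 ∧
    ∀ i : ℕ, D (lp.single 2 (i + 1) (1 : ℂ)) = w i • lp.single 2 i (1 : ℂ)

/-! Orthogonal complements carry (almost) invariant half-spaces of an operator to those of its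
adjoint, so it suffices to study `D`. No invariant half-space: let `M` be closed and invariant. If
its vectors have nonzero coordinates arbitrarily far out, then normalised iterates of `D`, stripped
of their lower coordinates, approximate each `eᵢ`, so `M = ⊤`
(`single_mem_of_forall_exists_coord_ne_zero`); otherwise `M` has finite dimension. Almost invariant
half-space: with `c k = w 0 ⋯ w (k-1)`, attach to `x` the entire function `f(z) = ∑ c k * x k * z ^
k`. Then `D` acts as `f ↦ (f - f(0)) / z`. Let `Y` consist of the `x` whose function vanishes at a
suitable infinite set of nonzero points. Dividing by `z` keeps these zeros, so only the condition
`f(0) = 0`, of codimension at most one in `Y`, obstructs invariance. -/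

open scoped InnerProductSpace
open Filter Topology

local notation "ℓ₂" => lp (fun _ : ℕ => ℂ) 2

/-! ### Duality through orthogonal complements. -/

namespace Submodule

variable {H : Type*} [NormedAddCommGroup H] [InnerProductSpace ℂ H] [CompleteSpace H]

theorem isHalfSpace_orthogonal {Y : Submodule ℂ H} (hY : IsHalfSpace Y) : IsHalfSpace Yᗮ := by
  obtain ⟨hc, hd, hq⟩ := hY
  have : CompleteSpace Y := hc.completeSpace_coe
  refine ⟨Y.isClosed_orthogonal, fun h => hq ?_, fun h => hd ?_⟩
  · exact (Y.quotientEquivOfIsCompl _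
      Y.isCompl_orthogonal).symm.finiteDimensional
  · exact (Yᗮ.quotientEquivOfIsCompl _
      Y.isCompl_orthogonal.symm).finiteDimensional

theorem isInvariantUnder_adjoint_orthogonal {T : H →L[ℂ] H} {Y : Submodule ℂ H}
    (hY : IsInvariantUnder T Y) : IsInvariantUnder (ContinuousLinearMap.adjoint T) Yᗮ := by
  intro z hz
  rw [mem_orthogonal]
  intro y hy
  rw [ContinuousLinearMap.adjoint_inner_right]
  exact inner_right_of_mem_orthogonal (hY y hy) hz

/-- Only the projection `G` of `F` to `Yᗮ` matters: the adjoint maps `Yᗮ ⊓ Gᗮ` into `Yᗮ`, and what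
remains of `Yᗮ` is the finite-dimensional `G`. -/
theorem isAlmostInvariantUnder_adjoint_orthogonal {T : H →L[ℂ] H} {Y : Submodule ℂ H}
    (hY : IsAlmostInvariantUnder T Y) :
    IsAlmostInvariantUnder (ContinuousLinearMap.adjoint T) Yᗮ := by
  obtain ⟨F, hF, hTF⟩ := hY
  set G : Submodule ℂ H := F.map (Yᗮ.starProjection : H →ₗ[ℂ] H) with hG
  have : FiniteDimensional ℂ G := inferInstanceAs (FiniteDimensional ℂ (F.map _))
  refine ⟨G.map (ContinuousLinearMap.adjoint T : H →ₗ[ℂ] H), inferInstance, fun z hz => ?_⟩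
  have hGY : G ≤ Yᗮ := by
    rintro _ ⟨f, -, rfl⟩
    exact Yᗮ.starProjection_apply_mem f
  have hdec : ContinuousLinearMap.adjoint T z =
      ContinuousLinearMap.adjoint T (z - G.starProjection z) +
        ContinuousLinearMap.adjoint T (G.starProjection z) := by
    rw [← map_add, sub_add_cancel]
  rw [hdec]
  refine add_mem (mem_sup_left ?_)
    (mem_sup_right (mem_map_of_mem (G.starProjection_apply_mem z)))
  have h1 : z - G.starProjection z ∈ Yᗮ := sub_mem hz (hGY (G.starProjection_apply_mem z))
  have h2 : z - G.starProjection z ∈ Gᗮ := sub_starProjection_mem_orthogonal z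
  rw [mem_orthogonal]
  intro y hy
  rw [ContinuousLinearMap.adjoint_inner_right]
  obtain ⟨y', hy', f, hf, hyf⟩ := mem_sup.1 (hTF y hy)
  have h3 : ⟪f - Yᗮ.starProjection f, z - G.starProjection z⟫_ℂ = 0 :=
    inner_left_of_mem_orthogonal h1 (sub_starProjection_mem_orthogonal f)
  have h4 : ⟪Yᗮ.starProjection f, z - G.starProjection z⟫_ℂ = 0 :=
    inner_right_of_mem_orthogonal (mem_map_of_mem hf) h2
  rw [← hyf, inner_add_left, inner_right_of_mem_orthogonal hy' h1, zero_add]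
  rwa [inner_sub_left, h4, sub_zero] at h3

end Submodule

/-! ### Coordinates and Donoghue's theorem. -/

/-- The `i`-th coordinate functional on `ℓ²`. -/
noncomputable def coordCLM (i : ℕ) : ℓ₂ →L[ℂ] ℂ := innerSL ℂ (lp.single 2 i (1 : ℂ))

@[simp] theorem coordCLM_apply (i : ℕ) (x : ℓ₂) : coordCLM i x = x i := by
  simp [coordCLM, lp.inner_single_left]

theorem IsDonoghue.exists_apply {D : ℓ₂ →L[ℂ] ℓ₂} (hD : IsDonoghue D) :
    ∃ w : ℕ → ℂ, (∀ i, w i ≠ 0) ∧ Antitone (fun i => ‖w i‖) ∧ Summable (fun i => ‖w i‖ ^ 2) ∧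
      ∀ x j, D x j = w j * x (j + 1) := by
  obtain ⟨w, h0, ha, hs, hD0, hD1⟩ := hD
  refine ⟨w, h0, ha, hs, fun x j => ?_⟩
  have h1 : HasSum (fun i => lp.single 2 i (x i)) x := lp.hasSum_single (by norm_num) x
  have h2 : HasSum (fun i => (coordCLM j ∘L D) (lp.single 2 i (x i))) _ :=
    (coordCLM j ∘L D).hasSum h1
  have hsingle : ∀ i, (lp.single 2 i (x i) : ℓ₂) = x i • lp.single 2 i (1 : ℂ) := by
    intro i
    rw [← lp.single_smul]
    simp
  have h3 := h2.unique (hasSum_single (j + 1) ?_)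
  · simpa [hsingle, hD1, mul_comm] using h3
  · rintro (_ | i) hi
    · simp [hsingle, hD0]
    · have : j ≠ i := fun h => hi (by rw [h])
      simp [hsingle, hD1, this]

theorem exists_dominating_coord {x : ℕ → ℂ} (hx : Tendsto x atTop (𝓝 0)) {N k : ℕ} (hk : N ≤ k)
    (hxk : x k ≠ 0) : ∃ n, N ≤ n ∧ x n ≠ 0 ∧ ∀ m, n ≤ m → ‖x m‖ ≤ ‖x n‖ := by
  have hx' : Tendsto (fun m => ‖x m‖) atTop (𝓝 0) := by simpa using hx.norm
  obtain ⟨K, hK⟩ := eventually_atTop.1 (hx'.eventually (gt_mem_nhds (norm_pos_iff.2 hxk)))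
  obtain ⟨n, hn, hmax⟩ := (Finset.Icc N (max k K)).exists_max_image (fun m => ‖x m‖)
    ⟨k, by simp [hk]⟩
  rw [Finset.mem_Icc] at hn
  have hkn : ‖x k‖ ≤ ‖x n‖ := hmax k (by simp [hk])
  refine ⟨n, hn.1, norm_pos_iff.1 ((norm_pos_iff.2 hxk).trans_le hkn), fun m hm => ?_⟩
  rcases le_total m (max k K) with h | h
  · exact hmax m (Finset.mem_Icc.2 ⟨hn.1.trans hm, h⟩)
  · exact (hK m ((le_max_right _ _).trans h)).le.trans hkn

theorem tendsto_coord_zero (x : ℓ₂) : Tendsto x atTop (𝓝 0) := by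
  have h := ((lp.memℓp x).summable (by norm_num)).tendsto_atTop_zero
  rw [tendsto_zero_iff_norm_tendsto_zero]
  have h' : Tendsto (fun i => ‖x i‖ ^ 2) atTop (𝓝 0) := by simpa using h
  simpa using h'.sqrt

theorem lp_norm_le_of_sq_le {z : ℓ₂} {g : ℕ → ℝ} {C : ℝ} (hC : 0 ≤ C) (hg : Summable g)
    (hz : ∀ j, ‖z j‖ ^ 2 ≤ g j) (hgC : ∑' j, g j ≤ C ^ 2) : ‖z‖ ≤ C := by
  have hz' : ∀ j, ‖z j‖ ^ (2 : ENNReal).toReal ≤ g j := by simpa using hz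
  refine lp.norm_le_of_tsum_le (by norm_num) hC ?_
  refine (((lp.memℓp z).summable (by norm_num)).tsum_le_tsum hz' hg).trans ?_
  simpa using hgC

theorem iterate_weightedShift_apply {D : ℓ₂ →L[ℂ] ℓ₂} {w : ℕ → ℂ}
    (hD : ∀ x j, D x j = w j * x (j + 1)) (m : ℕ) (x : ℓ₂) (j : ℕ) :
    (D^[m] x) j = (∏ l ∈ Finset.range m, w (j + l)) * x (j + m) := by
  induction m generalizing x with
  | zero => simp
  | succ m ih =>
    rw [Function.iterate_succ_apply, ih, hD, Finset.prod_range_succ, mul_assoc]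
    rfl

/-- With `w (j + p)` and `w i` set aside, the factors compare termwise, because `i + l + 1 ≤ j + l`.
-/
theorem norm_prod_shift_le {w : ℕ → ℂ} (hw : Antitone fun i => ‖w i‖) {i j p : ℕ} (hij : i < j) :
    ‖∏ l ∈ Finset.range (p + 1), w (j + l)‖ * ‖w i‖ ≤
      ‖w (j + p)‖ * ‖∏ l ∈ Finset.range (p + 1), w (i + l)‖ := by
  rw [Finset.prod_range_succ, Finset.prod_range_succ' (fun l => w (i + l))]
  simp only [norm_mul, norm_prod, add_zero]
  have h : ∏ l ∈ Finset.range p, ‖w (j + l)‖ ≤ ∏ l ∈ Finset.range p, ‖w (i + (l + 1))‖ :=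
    Finset.prod_le_prod (fun _ _ => norm_nonneg _) fun l _ => hw (by omega)
  calc _ ≤ ((∏ l ∈ Finset.range p, ‖w (i + (l + 1))‖) * ‖w (j + p)‖) * ‖w i‖ := by gcongr
    _ = _ := by ring

/-- If the coordinate `x (i + p + 1)` dominates all later ones, then a multiple of the iterate
`D ^ (p + 1) x` agrees with `eᵢ` beyond the first `i` coordinates, up to a tail of the weights. -/
theorem norm_iterate_weightedShift_ratio_le {D : ℓ₂ →L[ℂ] ℓ₂} {w : ℕ → ℂ}
    (hD : ∀ x j, D x j = w j * x (j + 1)) (h0 : ∀ i, w i ≠ 0) (hw : Antitone fun i => ‖w i‖)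
    {x : ℓ₂} {i p : ℕ} (hx0 : x (i + (p + 1)) ≠ 0)
    (hx : ∀ m, i + (p + 1) ≤ m → ‖x m‖ ≤ ‖x (i + (p + 1))‖) {j : ℕ} (hij : i < j) :
    ‖((D^[p + 1] x) i)⁻¹ * (D^[p + 1] x) j‖ ≤ ‖w (j + p)‖ / ‖w i‖ := by
  have hpi : (0 : ℝ) < ‖∏ l ∈ Finset.range (p + 1), w (i + l)‖ :=
    norm_pos_iff.2 (Finset.prod_ne_zero_iff.2 fun l _ => h0 _)
  have hxi := norm_pos_iff.2 hx0
  have hwi := norm_pos_iff.2 (h0 i)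
  rw [iterate_weightedShift_apply hD, iterate_weightedShift_apply hD, norm_mul, norm_inv,
    norm_mul, norm_mul, inv_mul_eq_div, div_le_div_iff₀ (by positivity) hwi]
  calc _ = (‖∏ l ∈ Finset.range (p + 1), w (j + l)‖ * ‖w i‖) * ‖x (j + (p + 1))‖ := by ring
    _ ≤ (‖w (j + p)‖ * ‖∏ l ∈ Finset.range (p + 1), w (i + l)‖) * ‖x (i + (p + 1))‖ :=
        mul_le_mul (norm_prod_shift_le hw hij) (hx _ (by omega)) (norm_nonneg _) (by positivity)
    _ = _ := by ring

theorem single_mem_of_forall_exists_coord_ne_zero {D : ℓ₂ →L[ℂ] ℓ₂} {w : ℕ → ℂ}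
    (hD : ∀ x j, D x j = w j * x (j + 1)) (h0 : ∀ i, w i ≠ 0) (hw : Antitone fun i => ‖w i‖)
    (hs : Summable fun i => ‖w i‖ ^ 2) {M : Submodule ℂ ℓ₂} (hc : IsClosed (M : Set ℓ₂))
    (hM : IsInvariantUnder D M) (h : ∀ N, ∃ x ∈ M, ∃ k, N ≤ k ∧ x k ≠ 0) (i : ℕ) :
    lp.single 2 i (1 : ℂ) ∈ M := by
  induction i using Nat.strong_induction_on with
  | _ i ih =>
  have hiter : ∀ m, ∀ x ∈ M, D^[m] x ∈ M := fun m => by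
    induction m with
    | zero => exact fun x hx => hx
    | succ m ihm => exact fun x hx => ihm _ (hM x hx)
  refine hc.closure_subset_iff.2 subset_rfl (Metric.mem_closure_iff.2 fun ε hε => ?_)
  have hwi := norm_pos_iff.2 (h0 i)
  -- The distance from `z` below to `eᵢ` is at most the `ℓ²` norm of a weight tail divided by `‖w
  -- i‖`.
  obtain ⟨P, hP⟩ := eventually_atTop.1 ((tendsto_sum_nat_add fun k => ‖w k‖ ^ 2).eventually
    (gt_mem_nhds (show 0 < (ε / 2 * ‖w i‖) ^ 2 by positivity)))
  obtain ⟨x, hxM, k, hk, hxk⟩ := h (i + (P + 1))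
  obtain ⟨n, hn, hxn, hmax⟩ := exists_dominating_coord (tendsto_coord_zero x) hk hxk
  obtain ⟨p, rfl⟩ : ∃ p, n = i + (p + 1) := ⟨n - i - 1, by omega⟩
  set y : ℓ₂ := D^[p + 1] x with hy
  have hyi : y i ≠ 0 := by
    rw [hy, iterate_weightedShift_apply hD]
    exact mul_ne_zero (Finset.prod_ne_zero_iff.2 fun l _ => h0 _) hxn
  have hyM : y ∈ M := hiter _ x hxM
  set z : ℓ₂ := (y i)⁻¹ • (y - ∑ j ∈ Finset.range i, y j • lp.single 2 j (1 : ℂ)) with hz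
  have hzM : z ∈ M := M.smul_mem _ (M.sub_mem hyM
    (M.sum_mem fun j hj => M.smul_mem _ (ih j (Finset.mem_range.1 hj))))
  have hzc : ∀ j, z j = (y i)⁻¹ * (if j < i then 0 else y j) := by
    intro j
    have hsum : (∑ l ∈ Finset.range i, y l • (lp.single 2 l (1 : ℂ) : ℓ₂)) j =
        if j < i then y j else 0 := by
      rw [← coordCLM_apply, map_sum]
      simp [Pi.single_apply]
    rw [hz, lp.coeFn_smul, Pi.smul_apply, lp.coeFn_sub, Pi.sub_apply, hsum, smul_eq_mul]
    split_ifs <;> simp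
  refine ⟨z, hzM, ?_⟩
  rw [dist_comm, dist_eq_norm]
  have hsum : Summable fun k => ‖w (k + p)‖ ^ 2 := (summable_nat_add_iff p).2 hs
  refine (lp_norm_le_of_sq_le (by positivity) (hsum.div_const (‖w i‖ ^ 2)) (C := ε / 2)
    (fun j => ?_) ?_).trans_lt (half_lt_self hε)
  · rw [lp.coeFn_sub, Pi.sub_apply, hzc, lp.coeFn_single]
    rcases lt_trichotomy j i with hj | rfl | hj
    · simp only [hj, if_true, Pi.single_eq_of_ne hj.ne, mul_zero, sub_zero, norm_zero,
        ne_eq, OfNat.ofNat_ne_zero, not_false_eq_true, zero_pow]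
      positivity
    · simp only [lt_irrefl, if_false, Pi.single_eq_same, inv_mul_cancel₀ hyi, sub_self, norm_zero,
        ne_eq, OfNat.ofNat_ne_zero, not_false_eq_true, zero_pow]
      positivity
    · simp only [hj.not_gt, if_false, Pi.single_eq_of_ne hj.ne', sub_zero]
      rw [← div_pow]
      gcongr
      exact norm_iterate_weightedShift_ratio_le hD h0 hw hxn hmax hj
  · rw [tsum_div_const, div_le_iff₀ (by positivity), ← mul_pow]
    exact (hP p (by omega)).le

theorem finiteDimensional_of_coord_eq_zero {M : Submodule ℂ ℓ₂} {N : ℕ}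
    (h : ∀ x ∈ M, ∀ k, N ≤ k → x k = 0) : FiniteDimensional ℂ M := by
  let f : M →ₗ[ℂ] (Fin N → ℂ) :=
    LinearMap.pi fun i => (coordCLM i : ℓ₂ →ₗ[ℂ] ℂ) ∘ₗ M.subtype
  refine FiniteDimensional.of_injective f (LinearMap.ker_eq_bot.1 (LinearMap.ker_eq_bot'.2 ?_))
  intro x hx
  refine Subtype.ext (lp.ext (funext fun k => ?_))
  rcases lt_or_ge k N with hk | hk
  · simpa [f] using congrFun hx ⟨k, hk⟩
  · simpa using h x x.2 k hk

theorem eq_top_of_single_mem {M : Submodule ℂ ℓ₂} (hc : IsClosed (M : Set ℓ₂))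
    (h : ∀ i, lp.single 2 i (1 : ℂ) ∈ M) : M = ⊤ := by
  refine eq_top_iff.2 fun x _ => ?_
  refine hc.mem_of_tendsto (lp.hasSum_single (by norm_num) x) (Eventually.of_forall fun s => ?_)
  refine M.sum_mem fun i _ => ?_
  have hi : (lp.single 2 i (x i) : ℓ₂) = x i • lp.single 2 i (1 : ℂ) := by
    rw [← lp.single_smul]
    simp
  rw [hi]
  exact M.smul_mem _ (h i)

/-- Donoghue's theorem: a closed invariant subspace of a Donoghue operator is finite-dimensional
or the whole space. -/
theorem IsDonoghue.finiteDimensional_or_eq_top {D : ℓ₂ →L[ℂ] ℓ₂} (hD : IsDonoghue D)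
    {M : Submodule ℂ ℓ₂} (hc : IsClosed (M : Set ℓ₂)) (hM : IsInvariantUnder D M) :
    FiniteDimensional ℂ M ∨ M = ⊤ := by
  obtain ⟨w, h0, hw, hs, hDw⟩ := hD.exists_apply
  by_cases h : ∀ N, ∃ x ∈ M, ∃ k, N ≤ k ∧ x k ≠ 0
  · exact Or.inr (eq_top_of_single_mem hc
      (single_mem_of_forall_exists_coord_ne_zero hDw h0 hw hs hc hM h))
  · push Not at h
    obtain ⟨N, hN⟩ := h
    exact Or.inl (finiteDimensional_of_coord_eq_zero hN)

theorem IsDonoghue.not_hasInvariantHalfSpace {D : ℓ₂ →L[ℂ] ℓ₂} (hD : IsDonoghue D) :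
    ¬ HasInvariantHalfSpace D := by
  rintro ⟨Y, ⟨hc, hd, hq⟩, hY⟩
  rcases hD.finiteDimensional_or_eq_top hc hY with h | rfl
  · exact hd h
  · exact hq inferInstance

theorem IsDonoghue.not_hasInvariantHalfSpace_adjoint {D : ℓ₂ →L[ℂ] ℓ₂} (hD : IsDonoghue D) :
    ¬ HasInvariantHalfSpace (ContinuousLinearMap.adjoint D) := by
  rintro ⟨Y, hY, hinv⟩
  refine hD.not_hasInvariantHalfSpace ⟨Yᗮ, Submodule.isHalfSpace_orthogonal hY, ?_⟩
  simpa using Submodule.isInvariantUnder_adjoint_orthogonal hinv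

/-! ### The almost invariant half-space. -/

open Polynomial in
/-- The products `∏ (1 - tₖ X)`, with `tₖ > 0` small, converge together with all their multiples
by powers of `X` after applying a given linear map into a Banach space. -/
theorem exists_tendsto_linearMap_products {E : Type*} [NormedAddCommGroup E] [NormedSpace ℂ E]
    [CompleteSpace E] (J : ℂ[X] →ₗ[ℂ] E) :
    ∃ (t : ℕ → ℝ) (P : ℕ → ℂ[X]), P 0 = 1 ∧ (∀ n, P (n + 1) = P n * (1 - C (t n : ℂ) * X)) ∧
      (∀ n, 0 < t n ∧ t n ≤ (1 / 2) ^ n) ∧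
      ∀ m, ∃ G, Tendsto (fun n => J (X ^ m * P n)) atTop (𝓝 G) := by
  -- The denominator makes step `n` move the multiples by `X ^ m`, for all `m ≤ n` at once, by at
  -- most `(1 / 2) ^ n`.
  let τ : ℕ → ℂ[X] → ℝ := fun n Q =>
    (1 / 2) ^ n / (1 + ∑ m ∈ Finset.range (n + 1), ‖J (X ^ (m + 1) * Q)‖)
  let P : ℕ → ℂ[X] := fun n => Nat.rec 1 (fun n Q => Q * (1 - C (τ n Q : ℂ) * X)) n
  have hden : ∀ n Q, 1 ≤ 1 + ∑ m ∈ Finset.range (n + 1), ‖J (X ^ (m + 1) * Q)‖ := fun n Q =>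
    le_add_of_nonneg_right (Finset.sum_nonneg fun _ _ => norm_nonneg _)
  have hpos : ∀ n Q, 0 < τ n Q := fun n Q =>
    div_pos (by positivity) (zero_lt_one.trans_le (hden n Q))
  have hstep : ∀ n, P (n + 1) = P n * (1 - C (τ n (P n) : ℂ) * X) := fun n => rfl
  have hsmall : ∀ m n, m ≤ n → τ n (P n) * ‖J (X ^ (m + 1) * P n)‖ ≤ (1 / 2) ^ n := by
    intro m n hmn
    rw [div_mul_eq_mul_div, div_le_iff₀ (zero_lt_one.trans_le (hden n _))]
    refine mul_le_mul_of_nonneg_left ?_ (by positivity)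
    exact (Finset.single_le_sum (f := fun m => ‖J (X ^ (m + 1) * P n)‖)
      (fun _ _ => norm_nonneg _) (Finset.mem_range.2 (Nat.lt_succ_of_le hmn))).trans
      (le_add_of_nonneg_left zero_le_one)
  refine ⟨fun n => τ n (P n), P, rfl, hstep, fun n => ⟨hpos _ _, ?_⟩, fun m => ?_⟩
  · exact div_le_self (by positivity) (hden n _)
  · have hc : CauchySeq fun n => J (X ^ m * P (n + m)) := by
      refine cauchySeq_of_le_geometric (1 / 2) 1 (by norm_num) fun n => ?_
      have h1 : X ^ m * P (n + m) - X ^ m * P (n + 1 + m) =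
          (τ (n + m) (P (n + m)) : ℂ) • (X ^ (m + 1) * P (n + m)) := by
        rw [show n + 1 + m = n + m + 1 by omega, hstep, smul_eq_C_mul]
        ring
      rw [dist_eq_norm, ← map_sub, h1, map_smul, norm_smul, Complex.norm_real,
        Real.norm_of_nonneg (hpos _ _).le, one_mul]
      exact (hsmall m (n + m) (by omega)).trans
        (pow_le_pow_of_le_one (by norm_num) (by norm_num) (by omega))
    obtain ⟨G, hG⟩ := cauchySeq_tendsto_of_complete hc
    exact ⟨G, (tendsto_add_atTop_iff_nat m).1 hG⟩

theorem summable_sq_norm_pow_mul_prod {w : ℕ → ℂ} (hw : Tendsto w atTop (𝓝 0)) (μ : ℂ) :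
    Summable fun k => ‖μ ^ k * ∏ l ∈ Finset.range k, w l‖ ^ 2 := by
  have h : Tendsto (fun k => ‖μ * w k‖ ^ 2) atTop (𝓝 0) := by
    simpa using ((hw.const_mul μ).norm.pow 2)
  refine summable_of_ratio_norm_eventually_le (r := 1 / 2) (by norm_num) ?_
  filter_upwards [h.eventually (gt_mem_nhds (show (0 : ℝ) < 1 / 2 by norm_num))] with k hk
  have he : ‖μ ^ (k + 1) * ∏ l ∈ Finset.range (k + 1), w l‖ ^ 2 =
      ‖μ * w k‖ ^ 2 * ‖μ ^ k * ∏ l ∈ Finset.range k, w l‖ ^ 2 := by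
    rw [Finset.prod_range_succ, ← mul_pow, ← norm_mul]
    ring_nf
  rw [he, norm_mul, Real.norm_of_nonneg (by positivity : 0 ≤ ‖μ * w k‖ ^ 2)]
  exact mul_le_mul_of_nonneg_right hk.le (norm_nonneg _)

/-- Evaluation at `μ` of the power series whose coefficients are the coordinates rescaled by
products of the weights is a continuous functional on `ℓ²`. -/
theorem exists_clm_hasSum_pow_mul_prod {w : ℕ → ℂ} (hw : Tendsto w atTop (𝓝 0)) (μ : ℂ) :
    ∃ φ : ℓ₂ →L[ℂ] ℂ, ∀ x : ℓ₂,
      HasSum (fun k => μ ^ k * (∏ l ∈ Finset.range k, w l) * x k) (φ x) := by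
  let v : ℓ₂ := ⟨fun k => star (μ ^ k * ∏ l ∈ Finset.range k, w l), memℓp_gen (by
    simpa only [norm_star, ENNReal.toReal_ofNat, Real.rpow_ofNat]
      using summable_sq_norm_pow_mul_prod hw μ)⟩
  refine ⟨innerSL ℂ v, fun x => ?_⟩
  have h := lp.hasSum_inner (𝕜 := ℂ) v x
  have hv : (fun k => inner ℂ (v k) (x k)) =
      fun k => μ ^ k * (∏ l ∈ Finset.range k, w l) * x k := by
    funext k
    simp [v, RCLike.inner_apply, mul_comm]
  rw [hv] at h
  exact h

open Polynomial in
/-- The linear map from polynomials to `ℓ²` dividing the `k`-th coefficient by `c k`. -/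
noncomputable def polynomialToL2 (c : ℕ → ℂ) : ℂ[X] →ₗ[ℂ] ℓ₂ where
  toFun p := ⟨fun k => p.coeff k / c k, (memℓp_zero (p.support.finite_toSet.subset fun k hk => by
    simp only [Set.mem_ofPred_eq, div_ne_zero_iff] at hk
    simpa using hk.1)).of_exponent_ge zero_le⟩
  map_add' p q := lp.ext (funext fun k => add_div _ _ _)
  map_smul' a p := lp.ext (funext fun k => mul_div_assoc _ _ _)

open Polynomial in
@[simp] theorem polynomialToL2_apply (c : ℕ → ℂ) (p : ℂ[X]) (k : ℕ) :
    polynomialToL2 c p k = p.coeff k / c k := rfl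

open Polynomial in
theorem hasSum_polynomialToL2_eval {c : ℕ → ℂ} (hc : ∀ k, c k ≠ 0) (μ : ℂ) (p : ℂ[X]) :
    HasSum (fun k => μ ^ k * c k * polynomialToL2 c p k) (p.eval μ) := by
  have h : (fun k => μ ^ k * c k * polynomialToL2 c p k) = fun k => p.coeff k * μ ^ k := by
    funext k
    have := hc k
    rw [polynomialToL2_apply]
    field_simp
  rw [h, eval_eq_sum_range]
  exact hasSum_sum_of_ne_finset_zero fun k hk => by
    rw [coeff_eq_zero_of_natDegree_lt (by simpa [Nat.lt_succ_iff] using hk), zero_mul]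

/-- The subspaces of `Y` with vanishing first `m` coordinates decrease strictly, as `G m` shows. -/
theorem not_finiteDimensional_of_leading_coord {Y : Submodule ℂ ℓ₂} {G : ℕ → ℓ₂}
    (hG : ∀ m, G m ∈ Y) (hG0 : ∀ m k, k < m → G m k = 0) (hG1 : ∀ m, G m m ≠ 0) :
    ¬ FiniteDimensional ℂ Y := by
  intro hY
  let V : ℕ → Submodule ℂ Y := fun m =>
    ⨅ k, ⨅ (_ : k < m), LinearMap.ker ((coordCLM k : ℓ₂ →ₗ[ℂ] ℂ) ∘ₗ Y.subtype)
  have hV : ∀ m y, y ∈ V m ↔ ∀ k < m, (y : ℓ₂) k = 0 := fun m y => by simp [V]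
  obtain ⟨n, hn⟩ := IsArtinian.monotone_stabilizes (R := ℂ) (M := Y)
    ⟨V, fun a b hab y hy => (hV a y).2 fun k hk => (hV b y).1 hy k (hk.trans_le hab)⟩
  have h1 : (⟨G n, hG n⟩ : Y) ∈ V n := (hV _ _).2 (hG0 n)
  have h2 : V n = V (n + 1) := hn (n + 1) n.le_succ
  rw [h2] at h1
  exact hG1 n ((hV _ _).1 h1 n n.lt_succ_self)

theorem infinite_range_inv_of_le_geometric {t : ℕ → ℝ} (ht : ∀ n, 0 < t n ∧ t n ≤ (1 / 2) ^ n) :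
    (Set.range fun n => ((t n : ℂ))⁻¹).Infinite := by
  intro hfin
  obtain ⟨C, hC⟩ := (hfin.image norm).bddAbove
  obtain ⟨n, hn⟩ := pow_unbounded_of_one_lt C (one_lt_two (α := ℝ))
  have h : ‖((t n : ℂ))⁻¹‖ ≤ C := hC ⟨_, ⟨n, rfl⟩, rfl⟩
  rw [norm_inv, Complex.norm_real, Real.norm_of_nonneg (ht n).1.le] at h
  have h2 := inv_anti₀ (ht n).1 (ht n).2
  rw [one_div, inv_pow, inv_inv] at h2
  linarith

theorem isAlmostInvariantUnder_of_coord_zero {D : ℓ₂ →L[ℂ] ℓ₂} {Y : Submodule ℂ ℓ₂}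
    (hY : ∀ y ∈ Y, y 0 = 0 → D y ∈ Y) : IsAlmostInvariantUnder D Y := by
  by_cases h : ∃ g ∈ Y, g 0 ≠ 0
  · obtain ⟨g, hg, hg0⟩ := h
    refine ⟨ℂ ∙ D g, inferInstance, fun y hy => ?_⟩
    have h1 : D (y - (y 0 / g 0) • g) ∈ Y :=
      hY _ (Y.sub_mem hy (Y.smul_mem _ hg)) (by
        rw [lp.coeFn_sub, Pi.sub_apply, lp.coeFn_smul, Pi.smul_apply, smul_eq_mul,
          div_mul_cancel₀ _ hg0, sub_self])
    rw [map_sub, map_smul] at h1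
    rw [← sub_add_cancel (D y) ((y 0 / g 0) • D g)]
    exact add_mem (Submodule.mem_sup_left h1)
      (Submodule.mem_sup_right (Submodule.smul_mem _ _ (Submodule.mem_span_singleton_self _)))
  · push Not at h
    exact ⟨⊥, inferInstance, fun y hy => Submodule.mem_sup_left (hY y hy (h y hy))⟩

open Polynomial in
theorem hasAlmostInvariantHalfSpace_weightedShift {D : ℓ₂ →L[ℂ] ℓ₂} {w : ℕ → ℂ}
    (hD : ∀ x j, D x j = w j * x (j + 1)) (h0 : ∀ i, w i ≠ 0) (hw : Tendsto w atTop (𝓝 0)) :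
    HasAlmostInvariantHalfSpace D := by
  set c : ℕ → ℂ := fun k => ∏ l ∈ Finset.range k, w l with hc
  have hc0 : ∀ k, c k ≠ 0 := fun k => Finset.prod_ne_zero_iff.2 fun l _ => h0 l
  obtain ⟨t, P, hP0, hP, ht, hlim⟩ := exists_tendsto_linearMap_products (polynomialToL2 c)
  choose G hG using hlim
  have ht0 : ∀ n, (t n : ℂ) ≠ 0 := fun n => Complex.ofReal_ne_zero.2 (ht n).1.ne'
  choose φ hφ using fun n => exists_clm_hasSum_pow_mul_prod hw ((t n : ℂ)⁻¹)
  have hφJ : ∀ n p, φ n (polynomialToL2 c p) = p.eval ((t n : ℂ)⁻¹) := fun n p =>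
    (hφ n _).unique (hasSum_polynomialToL2_eval hc0 _ p)
  have hPn : ∀ k n, k < n → (P n).eval ((t k : ℂ)⁻¹) = 0 := by
    intro k n hkn
    induction n, hkn using Nat.le_induction with
    | base => simp [hP, ht0]
    | succ n _ ih => rw [hP, eval_mul, ih, zero_mul]
  have hPc : ∀ n, (P n).coeff 0 = 1 := by
    intro n
    induction n with
    | zero => simp [hP0]
    | succ n ih => simp [hP, mul_coeff_zero, ih]
  set Y : Submodule ℂ ℓ₂ := ⨅ n, LinearMap.ker (φ n : ℓ₂ →ₗ[ℂ] ℂ) with hY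
  have hmem : ∀ y, y ∈ Y ↔ ∀ n, φ n y = 0 := fun y => by simp [hY]
  have hcoord : ∀ m k, Tendsto (fun n => (X ^ m * P n).coeff k / c k) atTop (𝓝 (G m k)) := by
    intro m k
    have h := ((coordCLM k).continuous.tendsto _).comp (hG m)
    rw [coordCLM_apply] at h
    exact h.congr fun n => by rw [Function.comp_apply, coordCLM_apply, polynomialToL2_apply]
  refine ⟨Y, ⟨?_, ?_, ?_⟩, isAlmostInvariantUnder_of_coord_zero fun y hy hy0 => ?_⟩
  · have : (Y : Set ℓ₂) = ⋂ n, {x | φ n x = 0} := by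
      ext x
      simp [hmem]
    rw [this]
    exact isClosed_iInter fun n => isClosed_eq (φ n).continuous continuous_const
  -- `G m` corresponds to `z ^ m` times the infinite product of the `1 - t k * z`.
  · refine not_finiteDimensional_of_leading_coord (G := G) (fun m => (hmem _).2 fun k => ?_)
      (fun m k hk => ?_) (fun m => ?_)
    · refine tendsto_nhds_unique (((φ k).continuous.tendsto _).comp (hG m))
        (tendsto_const_nhds.congr' ?_)
      filter_upwards [eventually_gt_atTop k] with n hn
      simp [hφJ, hPn k n hn]
    · refine tendsto_nhds_unique (hcoord m k) (tendsto_const_nhds.congr fun n => ?_)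
      rw [coeff_X_pow_mul', if_neg (by omega), zero_div]
    · have h1 : G m m = 1 / c m :=
        tendsto_nhds_unique (hcoord m m) (tendsto_const_nhds.congr fun n => by
          rw [coeff_X_pow_mul', if_pos le_rfl, Nat.sub_self, hPc])
      rw [h1]
      exact one_div_ne_zero (hc0 m)
  -- Polynomials embed in the quotient: a nonzero one cannot vanish at all the points `(t n)⁻¹`.
  · intro hfin
    refine Polynomial.not_finite (R := ℂ) (Module.Finite.of_injective
      (Y.mkQ ∘ₗ polynomialToL2 c) (LinearMap.ker_eq_bot.1 (LinearMap.ker_eq_bot'.2 fun p hp => ?_)))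
    have hpY : polynomialToL2 c p ∈ Y := by simpa using hp
    refine eq_zero_of_infinite_isRoot p ((infinite_range_inv_of_le_geometric ht).mono ?_)
    rintro _ ⟨n, rfl⟩
    exact (hφJ n p).symm.trans ((hmem _).1 hpY n)
  -- Since `y 0 = 0`, the series of `D y` at `(t n)⁻¹` is `t n` times that of `y`.
  · refine (hmem _).2 fun n => ?_
    have h1 := (hasSum_nat_add_iff' 1).2 (hφ n y)
    rw [Finset.sum_range_one, hy0, mul_zero, sub_zero, (hmem y).1 hy n] at h1
    have h2 := h1.mul_left (t n : ℂ)
    rw [mul_zero] at h2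
    refine (hφ n (D y)).unique ?_
    have h3 : (fun k => (t n : ℂ)⁻¹ ^ k * (∏ l ∈ Finset.range k, w l) * D y k) = fun k =>
        (t n : ℂ) * ((t n : ℂ)⁻¹ ^ (k + 1) * (∏ l ∈ Finset.range (k + 1), w l) * y (k + 1)) := by
      funext k
      rw [hD, Finset.prod_range_succ, pow_succ]
      have := ht0 n
      field_simp
    rw [h3]
    exact h2

theorem corollary3p5 (D : lp (fun _ : ℕ => ℂ) 2 →L[ℂ] lp (fun _ : ℕ => ℂ) 2)
    (hD : IsDonoghue D) :
    (HasAlmostInvariantHalfSpace D ∧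
      HasAlmostInvariantHalfSpace (ContinuousLinearMap.adjoint D)) ∧
    (¬ HasInvariantHalfSpace D ∧
      ¬ HasInvariantHalfSpace (ContinuousLinearMap.adjoint D)) := by
  obtain ⟨w, h0, -, hs, hDw⟩ := hD.exists_apply
  have hw : Tendsto w atTop (𝓝 0) := by
    rw [tendsto_zero_iff_norm_tendsto_zero]
    simpa using hs.tendsto_atTop_zero.sqrt
  obtain ⟨Y, hY, hinv⟩ := hasAlmostInvariantHalfSpace_weightedShift hDw h0 hw
  exact ⟨⟨⟨Y, hY, hinv⟩, Yᗮ, Submodule.isHalfSpace_orthogonal hY,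
    Submodule.isAlmostInvariantUnder_adjoint_orthogonal hinv⟩,
    hD.not_hasInvariantHalfSpace, hD.not_hasInvariantHalfSpace_adjoint⟩
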